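/- Let $\mathbb H$ be Hamilton's real quaternion algebra, with norm form $n(x)=x\bar x$, Euclidean inner product $\langle x,y\rangle=\mathrm{Re}(x\bar y)$ and conjugation $\kappa(x)=\bar x$. For $a\in\mathbb H^*$ put $L_a(x)=ax$ and $R_a(x)=xa$. Let $GO^+(\mathbb H)$ be the group of invertible linear maps $\varphi$ of $\mathbb H$ such that, for some $\mu\in\mathbb R$, $n(\varphi(x))=\mu\, n(x)$ for all $x$ and $\det\varphi=\mu^2$; let $PGL(\mathbb H)=GL(\mathbb H)/\mathbb R^*I$ and $PGO^+(\mathbb H)=GO^+(\mathbb H)/\mathbb R^*I$ (cosets are denoted by representatives). Every $\varphi\in GO^+(\mathbb H)$ has triality components, i.e. $\varphi_1,\varphi_2\in GO^+(\mathbb H)$ with $\varphi(xy)=\varphi_1(x)\varphi_2(y)$ for all $x,y$. Let $\mathrm{SPds}(\mathbb H)$ be the set of symmetric positive definite endomorphisms of $\mathbb H$ of determinant $1$, and $C_2=\{I,\kappa\}$; for $\lambda\in C_2$ write $\varphi^{\lambda}=\lambda\varphi\lambda$ and $\varphi^{-\lambda}=(\varphi^{\lambda})^{-1}$. The groupoid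 of an action of a group $G$ on a set $X$ has object set $X$, and its morphisms $x\to y$ are the $g\in G$ with $g\cdot x=y$. Let $\mathbb H^*$ act on $PGO^+(\mathbb H)^2$, and likewise on $PGL(\mathbb H)^2$, by $w\cdot(\zeta,\eta)=(R_w^{-1}\zeta,L_w\eta)$. Let $\mathscr Y(\mathbb H)$ be the groupoid of the $PGO^+(\mathbb H)$-action $$\varphi\cdot((\zeta,\eta),(\delta,\varepsilon),(\lambda,\mu))=\big((\varphi_1\zeta\varphi^{-\lambda},\varphi_2\eta\varphi^{-\mu}),(\varphi^\lambda\delta\varphi^{-\lambda},\varphi^\mu\varepsilon\varphi^{-\mu}),(\lambda,\mu)\big)$$ on $\big(PGO^+(\mathbb H)^2/\mathbb H^*\big)\times \mathrm{SPds}(\mathbb H)^2\times C_2^2$ (this does not depend on the choice of $\varphi_1,\varphi_2$). For $(i,j)\in\{-1,1\}^2$ let $\mathscr Y(\mathbb H)_{i,j}$ be the full subcategory of those objects $((\zeta,\eta),(\delta,\varepsilon),(\lambda,\mu))$ whose image $(\alpha,\beta)=(\zeta\delta\lambda,\eta\varepsilon\mu)\in PGL(\mathbb H)^2/\mathbb H^*$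 satisfies $(\mathrm{sign}\det\alpha,\mathrm{sign}\det\beta)=(i,j)$. For $s\in\mathbb H^*/\mathbb R^*$ put $c_s=L_sR_s^{-1}\in PGO^+(\mathbb H)$. **Proposition.** Let $\mathscr Z$ be the groupoid of the action of $\mathbb H^*/\mathbb R^*$ on $(\mathbb H^*/\mathbb R^*)^2\times \mathrm{SPds}(\mathbb H)^2$ given by $$s\cdot((a,b),(\delta,\varepsilon))=\big((sas^{-1},sbs^{-1}),(c_s\delta c_s^{-1},c_s\varepsilon c_s^{-1})\big).$$ For each $(i,j)\in\{-1,1\}^2$ the category $\mathscr Y(\mathbb H)_{i,j}$ is equivalent to $\mathscr Z$. An equivalence $\mathscr H_{i,j}:\mathscr Z\to\mathscr Y(\mathbb H)_{i,j}$ is given by $\mathscr H_{i,j}(s)=c_s$ on morphisms, and on objects by $$\mathscr H_{1,1}((a,b),(\delta,\varepsilon))=((L_a,R_b),(\delta,\varepsilon),(I,I)),$$ $$\mathscr H_{-1,1}((a,b),(\delta,\varepsilon))=((R_a,R_b),(\delta,\varepsilon),(\kappa,I)),$$ $$\mathscr H_{1,-1}((a,b),(\delta,\varepsilon))=((L_a,L_b),(\delta,\varepsilon),(I,\kappa)),$$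 $$\mathscr H_{-1,-1}((a,b),(\delta,\varepsilon))=((L_a,R_b),(\delta,\varepsilon),(\kappa,\kappa)).$$ -/

import Mathlib

open CategoryTheory

open scoped Quaternion

namespace QuatIsotopes

noncomputable section

/-- Hamilton's quaternions. -/
abbrev H : Type := Quaternion ℝ

/-- The general linear group of the real vector space `H`. -/
abbrev GLH : Type := H ≃ₗ[ℝ] H

/-! ### Left and right multiplications, the involution -/

/-- Left multiplication `x ↦ a x`. -/
def lmul (a : Hˣ) : GLH where
  toFun x := a * x
  invFun x := ↑a⁻¹ * x
  map_add' x y := mul_add _ x y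
  map_smul' r x := mul_smul_comm r _ x
  left_inv x := by simp
  right_inv x := by simp

/-- Right multiplication `x ↦ x a`. -/
def rmul (a : Hˣ) : GLH where
  toFun x := x * a
  invFun x := x * ↑a⁻¹
  map_add' x y := add_mul x y _
  map_smul' r x := smul_mul_assoc r x _
  left_inv x := by simp
  right_inv x := by simp

/-- The canonical involution `κ`, `x ↦ x̄`. -/
def kappa : GLH where
  toFun x := star x
  invFun x := star x
  map_add' x y := star_add x y
  map_smul' r x := by simp
  left_inv x := star_star x
  right_inv x := star_star x

@[simp] theorem lmul_apply (a : Hˣ) (x : H) : lmul a x = a * x := rfl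
@[simp] theorem rmul_apply (a : Hˣ) (x : H) : rmul a x = x * a := rfl
@[simp] theorem kappa_apply (x : H) : kappa x = star x := rfl

theorem lmul_mul (a b : Hˣ) : lmul (a * b) = lmul a * lmul b := by
  ext1 x; simp [LinearEquiv.mul_apply, mul_assoc]

theorem rmul_mul (a b : Hˣ) : rmul (a * b) = rmul b * rmul a := by
  ext1 x; simp [LinearEquiv.mul_apply, mul_assoc]

theorem lmul_one : lmul 1 = 1 := by ext1 x; simp
theorem rmul_one : rmul 1 = 1 := by ext1 x; simp

theorem kappa_mul_self : kappa * kappa = 1 := by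
  ext1 x; simp [LinearEquiv.mul_apply]

/-- The group `C₂ = {I, κ}`. -/
def C2 : Subgroup GLH where
  carrier := {1, kappa}
  one_mem' := by simp
  mul_mem' := by
    rintro a b (rfl | rfl) (rfl | rfl) <;> simp [kappa_mul_self]
  inv_mem' := by
    rintro a (rfl | rfl)
    · simp
    · right; exact inv_eq_of_mul_eq_one_left kappa_mul_self

/-- `κ` as an element of `C₂`. -/
def kappa2 : C2 := ⟨kappa, Or.inr rfl⟩

/-! ### Similitudes -/

/-- `φ` is a similitude of `(H, n)` with multiplier `μ`, where `n = normSq` is the norm form. -/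
def IsSimilitude (φ : GLH) (μ : ℝ) : Prop :=
  ∀ x : H, Quaternion.normSq (φ x) = μ * Quaternion.normSq x

theorem IsSimilitude.pos {φ : GLH} {μ : ℝ} (h : IsSimilitude φ μ) : 0 < μ := by
  have h1 := h 1
  rw [Quaternion.normSq.map_one, mul_one] at h1
  rw [← h1]
  have h2 : φ 1 ≠ 0 := by simp
  exact lt_of_le_of_ne Quaternion.normSq_nonneg
    (fun h => h2 (Quaternion.normSq_eq_zero.1 h.symm))

theorem IsSimilitude.inner_eq {φ : GLH} {μ : ℝ} (h : IsSimilitude φ μ) (x y : H) :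
    inner ℝ (φ x) (φ y) = μ * inner ℝ x y := by
  have e (x y : H) : Quaternion.normSq (x + y)
      = Quaternion.normSq x + Quaternion.normSq y + 2 * inner ℝ x y := by
    rw [Quaternion.normSq_add, Quaternion.inner_def]
  have h1 := h (x + y)
  rw [map_add, e, e, h x, h y] at h1
  linarith

/-- `GO⁺(H)`, the group of proper similitudes: those with `det φ = μ(φ)^2`, `2 = (dim H)/2`. -/
def GOp : Subgroup GLH where
  carrier := {φ | ∃ μ : ℝ, IsSimilitude φ μ ∧ LinearMap.det (φ : H →ₗ[ℝ] H) = μ ^ 2}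
  one_mem' := ⟨1, fun x => by simp, by simp⟩
  mul_mem' := by
    rintro a b ⟨μ, h1, h2⟩ ⟨ν, h3, h4⟩
    refine ⟨μ * ν, fun x => ?_, ?_⟩
    · rw [LinearEquiv.mul_apply, h1, h3, mul_assoc]
    · have : ((a * b : GLH) : H →ₗ[ℝ] H) = (a : H →ₗ[ℝ] H) * (b : H →ₗ[ℝ] H) := rfl
      rw [this, map_mul, h2, h4, mul_pow]
  inv_mem' := by
    rintro a ⟨μ, h1, h2⟩
    have hμ := h1.pos
    refine ⟨μ⁻¹, fun x => ?_, ?_⟩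
    · have := h1 (a⁻¹ x)
      have e : a (a⁻¹ x) = x := a.apply_symm_apply x
      rw [e] at this
      rw [this]; field_simp
    · have : ((a⁻¹ : GLH) : H →ₗ[ℝ] H) * (a : H →ₗ[ℝ] H) = 1 := by
        ext1 x; exact a.symm_apply_apply x
      have h := congrArg LinearMap.det this
      rw [map_mul, h2, map_one] at h
      field_simp
      linarith

theorem IsSimilitude.det_eq {φ : GLH} (hφ : φ ∈ GOp) {μ : ℝ} (h : IsSimilitude φ μ) :
    LinearMap.det (φ : H →ₗ[ℝ] H) = μ ^ 2 := by
  obtain ⟨ν, h1, h2⟩ := hφ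
  have e1 := h 1
  have e2 := h1 1
  rw [e1] at e2
  simp at e2
  rw [h2, e2]

/-- The imaginary units of `H`. -/
def qI : H := ⟨0, 1, 0, 0⟩
def qJ : H := ⟨0, 0, 1, 0⟩
def qK : H := ⟨0, 0, 0, 1⟩

@[simp] theorem qI_re : qI.re = 0 := rfl
@[simp] theorem qI_imI : qI.imI = 1 := rfl
@[simp] theorem qI_imJ : qI.imJ = 0 := rfl
@[simp] theorem qI_imK : qI.imK = 0 := rfl
@[simp] theorem qJ_re : qJ.re = 0 := rfl
@[simp] theorem qJ_imI : qJ.imI = 0 := rfl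
@[simp] theorem qJ_imJ : qJ.imJ = 1 := rfl
@[simp] theorem qJ_imK : qJ.imK = 0 := rfl
@[simp] theorem qK_re : qK.re = 0 := rfl
@[simp] theorem qK_imI : qK.imI = 0 := rfl
@[simp] theorem qK_imJ : qK.imJ = 0 := rfl
@[simp] theorem qK_imK : qK.imK = 1 := rfl

/-- The determinant of an endomorphism of `H` in the basis `1, i, j, k`. -/
theorem det_formula (f : H →ₗ[ℝ] H) (u v w : H) (t : H) (ht : f 1 = t)
    (hu : f qI = u) (hv : f qJ = v) (hw : f qK = w) :
    LinearMap.det f = Matrix.det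
      !![t.re, u.re, v.re, w.re; t.imI, u.imI, v.imI, w.imI;
         t.imJ, u.imJ, v.imJ, w.imJ; t.imK, u.imK, v.imK, w.imK] := by
  let B : Module.Basis (Fin 4) ℝ H := QuaternionAlgebra.basisOneIJK (-1 : ℝ) 0 (-1)
  have hr (q : H) : B.repr q = ![q.re, q.imI, q.imJ, q.imK] :=
    QuaternionAlgebra.coe_basisOneIJK_repr (-1 : ℝ) 0 (-1) q
  have b (n : Fin 4) : B n = ![(1 : H), qI, qJ, qK] n := by
    apply B.repr.injective
    rw [B.repr_self]
    ext m
    rw [hr]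
    fin_cases n <;> fin_cases m <;> simp
  rw [← LinearMap.det_toMatrix B f]
  congr 1
  ext m n
  rw [LinearMap.toMatrix_apply, hr, b]
  fin_cases n <;> fin_cases m <;> simp [ht, hu, hv, hw]

theorem lmul_similitude (a : Hˣ) : IsSimilitude (lmul a) (Quaternion.normSq (a : H)) :=
  fun x => by simp

theorem rmul_similitude (a : Hˣ) : IsSimilitude (rmul a) (Quaternion.normSq (a : H)) :=
  fun x => by simp [mul_comm]

theorem lmul_mem (a : Hˣ) : lmul a ∈ GOp := by
  refine ⟨_, lmul_similitude a, ?_⟩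
  rw [det_formula (lmul a : H →ₗ[ℝ] H) ((a : H) * qI) ((a : H) * qJ)
    ((a : H) * qK) ((a : H) * 1) rfl rfl rfl rfl]
  simp [Matrix.det_succ_row_zero, Fin.sum_univ_succ, Quaternion.normSq_def', Fin.succAbove]
  ring

theorem rmul_mem (a : Hˣ) : rmul a ∈ GOp := by
  refine ⟨_, rmul_similitude a, ?_⟩
  rw [det_formula (rmul a : H →ₗ[ℝ] H) (qI * (a : H)) (qJ * (a : H))
    (qK * (a : H)) (1 * (a : H)) rfl rfl rfl rfl]
  simp [Matrix.det_succ_row_zero, Fin.sum_univ_succ, Quaternion.normSq_def', Fin.succAbove]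
  ring

theorem inner_formula (x y : H) :
    inner ℝ x y = x.re * y.re + x.imI * y.imI + x.imJ * y.imJ + x.imK * y.imK := by
  rw [Quaternion.inner_def]; simp

theorem cross_aux (a b c d e f x y z : ℝ) (h1 : a * a + b * b + c * c = 1)
    (h2 : d * d + e * e + f * f = 1) (h3 : x * x + y * y + z * z = 1)
    (h4 : a * d + b * e + c * f = 0)
    (h5 : a * (e * z - y * f) - d * (b * z - y * c) + x * (b * f - e * c) = 1) :
    x = b * f - c * e ∧ y = c * d - a * f ∧ z = a * e - b * d := by
  have h : (x - (b * f - c * e)) ^ 2 + (y - (c * d - a * f)) ^ 2 + (z - (a * e - b * d)) ^ 2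
      = 0 := by
    linear_combination h3 + (d * d + e * e + f * f) * h1 + h2
      - (a * d + b * e + c * f) * h4 - 2 * h5
  have p1 := sq_nonneg (x - (b * f - c * e))
  have p2 := sq_nonneg (y - (c * d - a * f))
  have p3 := sq_nonneg (z - (a * e - b * d))
  refine ⟨sub_eq_zero.1 (pow_eq_zero_iff two_ne_zero |>.1 (by linarith)),
    sub_eq_zero.1 (pow_eq_zero_iff two_ne_zero |>.1 (by linarith)),
    sub_eq_zero.1 (pow_eq_zero_iff two_ne_zero |>.1 (by linarith))⟩

/-- A proper isometry fixing `1` is multiplicative. -/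
theorem mul_of_fix_one {ψ : GLH} (hψ : ψ ∈ GOp) (h1 : ψ 1 = 1) (x y : H) :
    ψ (x * y) = ψ x * ψ y := by
  have hs : IsSimilitude ψ 1 := by
    obtain ⟨μ, hμ, -⟩ := hψ
    have := hμ 1
    rw [h1] at this
    simp at this
    rwa [← this] at hμ
  have hdet := hs.det_eq hψ
  obtain ⟨u, hu⟩ : ∃ u, ψ qI = u := ⟨_, rfl⟩
  obtain ⟨v, hv⟩ : ∃ u, ψ qJ = u := ⟨_, rfl⟩
  obtain ⟨w, hw⟩ : ∃ u, ψ qK = u := ⟨_, rfl⟩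
  rw [det_formula (ψ : H →ₗ[ℝ] H) u v w 1 h1 hu hv hw] at hdet
  have a1 := hs.inner_eq qI 1
  have a2 := hs.inner_eq qJ 1
  have a3 := hs.inner_eq qK 1
  have b1 := hs.inner_eq qI qI
  have b2 := hs.inner_eq qJ qJ
  have b3 := hs.inner_eq qK qK
  have c1 := hs.inner_eq qI qJ
  rw [hu, h1] at a1
  rw [hv, h1] at a2
  rw [hw, h1] at a3
  rw [hu] at b1
  rw [hv] at b2
  rw [hw] at b3
  rw [hu, hv] at c1
  simp only [inner_formula, qI_re, qI_imI, qI_imJ, qI_imK, qJ_re, qJ_imI, qJ_imJ, qJ_imK,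
    qK_re, qK_imI, qK_imJ, qK_imK, Quaternion.re_one, Quaternion.imI_one, Quaternion.imJ_one,
    Quaternion.imK_one, mul_one, mul_zero, add_zero, zero_add] at a1 a2 a3 b1 b2 b3 c1
  simp only [a1, a2, a3, mul_zero, zero_add] at b1 b2 b3 c1
  simp [Matrix.det_succ_row_zero, Fin.sum_univ_succ, Fin.succAbove, a1, a2, a3] at hdet
  obtain ⟨d1, d2, d3⟩ := cross_aux _ _ _ _ _ _ _ _ _ b1 b2 b3 c1 (by linarith)
  let B : QuaternionAlgebra.Basis H (-1 : ℝ) 0 (-1) :=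
    { i := u, j := v, k := w
      i_mul_i := by ext <;> simp [a1] <;> linarith
      j_mul_j := by ext <;> simp [a2] <;> linarith
      i_mul_j := by ext <;> simp [a1, a2, a3] <;> linarith
      j_mul_i := by ext <;> simp [a1, a2, a3] <;> linarith }
  have hB (z : H) : ψ z = B.lift z := by
    have : z = z.re • (1 : H) + z.imI • qI + z.imJ • qJ + z.imK • qK := by
      ext <;> simp
    conv_lhs => rw [this]
    simp only [map_add, map_smul, hu, hv, hw, h1]
    simp only [QuaternionAlgebra.Basis.lift, Algebra.algebraMap_eq_smul_one, B]
  rw [hB, hB, hB]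
  exact B.lift_mul x y

/-- `L_a` as a proper similitude. -/
def Lg (a : Hˣ) : GOp := ⟨lmul a, lmul_mem a⟩

/-- `R_a` as a proper similitude. -/
def Rg (a : Hˣ) : GOp := ⟨rmul a, rmul_mem a⟩

theorem Lg_mul (a b : Hˣ) : Lg (a * b) = Lg a * Lg b := Subtype.ext (lmul_mul a b)
theorem Rg_mul (a b : Hˣ) : Rg (a * b) = Rg b * Rg a := Subtype.ext (rmul_mul a b)
theorem Lg_one : Lg 1 = 1 := Subtype.ext lmul_one
theorem Rg_one : Rg 1 = 1 := Subtype.ext rmul_one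

theorem Lg_comm_Rg (a b : Hˣ) : Lg a * Rg b = Rg b * Lg a := by
  apply Subtype.ext
  ext1 x
  exact (mul_assoc (a : H) x b).symm

/-! ### Triality components -/

/-- `φ₁, φ₂` are triality components of `φ`. -/
def IsTriality (φ φ₁ φ₂ : GOp) : Prop :=
  ∀ x y : H, φ.1 (x * y) = φ₁.1 x * φ₂.1 y

theorem exists_triality (φ : GOp) : ∃ φ₁ φ₂ : GOp, IsTriality φ φ₁ φ₂ := by
  have h : φ.1 1 ≠ 0 := by simp
  let a : Hˣ := Units.mk0 _ h
  have key (x : H) : φ.1 x = a * ((Lg a)⁻¹ * φ).1 x :=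
    ((lmul a).apply_symm_apply (φ.1 x)).symm
  have h1 : ((Lg a)⁻¹ * φ).1 1 = 1 := by
    have := key 1
    exact (mul_eq_left₀ a.ne_zero).1 this.symm
  refine ⟨φ, (Lg a)⁻¹ * φ, fun x y => ?_⟩
  rw [key, mul_of_fix_one ((Lg a)⁻¹ * φ).2 h1, ← mul_assoc, ← key]

theorem IsTriality.mul {φ φ₁ φ₂ ψ ψ₁ ψ₂ : GOp} (h : IsTriality φ φ₁ φ₂)
    (h' : IsTriality ψ ψ₁ ψ₂) : IsTriality (φ * ψ) (φ₁ * ψ₁) (φ₂ * ψ₂) := fun x y =>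
  (congrArg φ.1 (h' x y)).trans (h _ _)

theorem IsTriality.unique {φ φ₁ φ₂ ψ₁ ψ₂ : GOp} (h : IsTriality φ φ₁ φ₂)
    (h' : IsTriality φ ψ₁ ψ₂) : ∃ w : Hˣ, ψ₁ = (Rg w)⁻¹ * φ₁ ∧ ψ₂ = Lg w * φ₂ := by
  have n2 : φ₂.1 1 ≠ 0 := by simp
  have m2 : ψ₂.1 1 ≠ 0 := by simp
  have m1 : ψ₁.1 1 ≠ 0 := by simp
  have e1 (x : H) : φ₁.1 x * φ₂.1 1 = ψ₁.1 x * ψ₂.1 1 := by rw [← h, ← h']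
  have e2 (y : H) : φ₁.1 1 * φ₂.1 y = ψ₁.1 1 * ψ₂.1 y := by rw [← h, ← h']
  let w : Hˣ := Units.mk0 _ m2 * (Units.mk0 _ n2)⁻¹
  have hw : (w : H) = ψ₂.1 1 * (φ₂.1 1)⁻¹ := by simp [w]
  have e3 (x : H) : φ₁.1 x = ψ₁.1 x * w := by
    rw [hw, ← mul_assoc, ← e1, mul_assoc, mul_inv_cancel₀ n2, mul_one]
  refine ⟨w, eq_inv_mul_of_mul_eq (Subtype.ext ?_), Subtype.ext ?_⟩
  · ext1 x
    exact (e3 x).symm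
  · ext1 y
    have := e2 y
    rw [e3 1, mul_assoc] at this
    exact (mul_left_cancel₀ m1 this).symm

theorem IsTriality.shift {φ φ₁ φ₂ : GOp} (h : IsTriality φ φ₁ φ₂) (w : Hˣ) :
    IsTriality φ (φ₁ * (Rg w)⁻¹) (φ₂ * Lg w) := by
  intro x y
  have e : ((Rg w)⁻¹ : GOp).1 x = x * ↑w⁻¹ := rfl
  change _ = φ₁.1 (((Rg w)⁻¹ : GOp).1 x) * φ₂.1 (w * y)
  rw [e, ← h, mul_assoc, ← mul_assoc _ (w : H) y]
  simp

/-! ### Projective groups -/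

/-- The group `ℝ^* I` of homotheties. -/
def scalars : Subgroup GLH := (DistribMulAction.toModuleAut ℝ H (S := ℝˣ)).range

theorem mem_scalars {φ : GLH} : φ ∈ scalars ↔ ∃ ρ : ℝˣ, ∀ x, φ x = (ρ : ℝ) • x := by
  constructor
  · rintro ⟨ρ, rfl⟩
    exact ⟨ρ, fun x => rfl⟩
  · rintro ⟨ρ, h⟩
    exact ⟨ρ, LinearEquiv.ext fun x => (h x).symm⟩

instance : scalars.Normal := by
  constructor
  intro n hn g
  obtain ⟨ρ, h⟩ := mem_scalars.1 hn
  refine mem_scalars.2 ⟨ρ, fun x => ?_⟩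
  change g (n (g.symm x)) = _
  rw [h, map_smul, g.apply_symm_apply]

/-- `PGL(H) = GL(H) / ℝ^* I`. -/
abbrev PGL : Type := GLH ⧸ scalars

/-- `PGO⁺(H) = GO⁺(H) / ℝ^* I`. -/
abbrev PGOp : Type := GOp ⧸ scalars.subgroupOf GOp

/-- The inclusion `PGO⁺(H) → PGL(H)`. -/
def inclPGL : PGOp →* PGL :=
  QuotientGroup.map (scalars.subgroupOf GOp) scalars GOp.subtype le_rfl

/-- An action of `G` for which the normal subgroup `N` acts trivially induces an action
of `G / N`. -/
abbrev descendAction {G X : Type} [Group G] (N : Subgroup G) [N.Normal] [MulAction G X]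
    (h : ∀ n ∈ N, ∀ x : X, n • x = x) : MulAction (G ⧸ N) X :=
  MulAction.compHom X
    (QuotientGroup.lift N (MulAction.toPermHom G X) fun n hn => Equiv.ext (h n hn))

/-- The group `H^* = N(H)^*` acts on pairs by `w · (ζ, η) = (R_w⁻¹ ζ, L_w η)`, here for
pairs in any group `G` to which `GO⁺(H)` maps. -/
abbrev nuclearAction {G : Type} [Group G] (f : GOp →* G) : MulAction Hˣ (G × G) where
  smul w p := ((f (Rg w))⁻¹ * p.1, f (Lg w) * p.2)
  one_smul p := by
    change ((f (Rg 1))⁻¹ * p.1, f (Lg 1) * p.2) = p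
    simp [Lg_one, Rg_one]
  mul_smul v w p := by
    change ((f (Rg (v * w)))⁻¹ * p.1, f (Lg (v * w)) * p.2)
      = ((f (Rg v))⁻¹ * ((f (Rg w))⁻¹ * p.1), f (Lg v) * (f (Lg w) * p.2))
    simp [Lg_mul, Rg_mul, mul_assoc]

/-- Being in the same `H^*`-orbit. -/
def nuclearSetoid {G : Type} [Group G] (f : GOp →* G) : Setoid (G × G) :=
  letI := nuclearAction f
  MulAction.orbitRel Hˣ (G × G)

theorem nuclearSetoid_rel {G : Type} [Group G] (f : GOp →* G) (p q : G × G) :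
    (nuclearSetoid f).r p q ↔ ∃ w : Hˣ, ((f (Rg w))⁻¹ * q.1, f (Lg w) * q.2) = p := Iff.rfl

/-- `X_H = PGL(H)² / H^*`, the object set of the groupoid `𝒳(H)`. -/
abbrev XObj : Type :=
  Quotient (nuclearSetoid ((QuotientGroup.mk' scalars).comp GOp.subtype))

/-- `PGO⁺(H)² / H^*`. -/
abbrev YPair : Type :=
  Quotient (nuclearSetoid (QuotientGroup.mk' (scalars.subgroupOf GOp)))

/-- The class of `(ζ, η)` in `PGO⁺(H)² / H^*`. -/
def YPair.mk (ζ η : PGOp) : YPair := Quotient.mk _ (ζ, η)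

/-! ### The action of `C₂` on proper similitudes -/

theorem C2_isometry (l : C2) : IsSimilitude l.1 1 := by
  obtain ⟨l, rfl | rfl⟩ := l
  · intro x; simp
  · intro x; simp [Quaternion.normSq_star]

/-- `φ ↦ φ^λ = λ φ λ` (`= λ φ λ⁻¹`) on `GO⁺(H)`. -/
def conjC (l : C2) : GOp →* GOp where
  toFun φ := ⟨l.1 * φ.1 * l.1⁻¹, by
    obtain ⟨φ, μ, h1, h2⟩ := φ
    refine ⟨μ, fun x => ?_, ?_⟩
    · change Quaternion.normSq (l.1 (φ (l.1.symm x))) = _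
      rw [C2_isometry, one_mul, h1]
      congr 1
      have := C2_isometry l (l.1.symm x)
      rw [l.1.apply_symm_apply, one_mul] at this
      exact this.symm
    · exact (LinearMap.det_conj (φ : H →ₗ[ℝ] H) l.1).trans h2⟩
  map_one' := Subtype.ext (by simp)
  map_mul' φ ψ := Subtype.ext (by simp [mul_assoc])

theorem conjC_scalar (l : C2) {φ : GOp} (h : φ ∈ scalars.subgroupOf GOp) :
    conjC l φ ∈ scalars.subgroupOf GOp :=
  (inferInstance : scalars.Normal).conj_mem _ h l.1

/-- `φ ↦ φ^λ` on `PGO⁺(H)`. -/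
def conjP (l : C2) : PGOp →* PGOp :=
  QuotientGroup.map _ _ (conjC l) fun _ h => conjC_scalar l h

/-! ### Positive definite symmetric maps of determinant one -/

/-- `SPds(H)`: symmetric positive definite endomorphisms of the Euclidean space `H` with
determinant one. -/
@[ext] structure SPds : Type where
  /-- the underlying linear automorphism -/
  toGL : GLH
  symm : ∀ x y : H, inner ℝ (toGL x) y = inner ℝ x (toGL y)
  pos : ∀ x : H, x ≠ 0 → 0 < inner ℝ (toGL x) x
  det : LinearMap.det (toGL : H →ₗ[ℝ] H) = 1

/-- `φ · δ = φ δ φ⁻¹` for `φ ∈ GO⁺(H)`. -/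
def conjSPds (φ : GOp) (δ : SPds) : SPds where
  toGL := φ.1 * δ.toGL * φ.1⁻¹
  symm x y := by
    obtain ⟨φ, μ, h, -⟩ := φ
    obtain ⟨x, rfl⟩ := φ.surjective x
    obtain ⟨y, rfl⟩ := φ.surjective y
    change inner ℝ (φ (δ.toGL (φ.symm (φ x)))) (φ y) = inner ℝ (φ x) (φ (δ.toGL (φ.symm (φ y))))
    rw [φ.symm_apply_apply, φ.symm_apply_apply, h.inner_eq, h.inner_eq, δ.symm]
  pos x hx := by
    obtain ⟨φ, μ, h, -⟩ := φ
    obtain ⟨x, rfl⟩ := φ.surjective x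
    change 0 < inner ℝ (φ (δ.toGL (φ.symm (φ x)))) (φ x)
    rw [φ.symm_apply_apply, h.inner_eq]
    exact mul_pos h.pos (δ.pos x fun h0 => hx (by rw [h0, map_zero]))
  det := (LinearMap.det_conj (δ.toGL : H →ₗ[ℝ] H) φ.1).trans δ.det

instance : MulAction GOp SPds where
  smul := conjSPds
  one_smul δ := SPds.ext (by change (1 : GLH) * δ.toGL * (1 : GLH)⁻¹ = _; simp)
  mul_smul φ ψ δ := SPds.ext (by
    change (φ.1 * ψ.1) * δ.toGL * (φ.1 * ψ.1)⁻¹ = φ.1 * (ψ.1 * δ.toGL * ψ.1⁻¹) * φ.1⁻¹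
    simp [mul_assoc])

theorem smul_SPds_toGL (φ : GOp) (δ : SPds) : (φ • δ).toGL = φ.1 * δ.toGL * φ.1⁻¹ := rfl

theorem scalar_smul_SPds (φ : GOp) (h : φ ∈ scalars.subgroupOf GOp) (δ : SPds) : φ • δ = δ := by
  apply SPds.ext
  rw [smul_SPds_toGL]
  obtain ⟨ρ, hρ⟩ := mem_scalars.1 (Subgroup.mem_subgroupOf.1 h)
  rw [mul_inv_eq_iff_eq_mul]
  ext1 x
  change φ.1 (δ.toGL x) = δ.toGL (φ.1 x)
  rw [hρ, hρ, map_smul]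

/-- `PGO⁺(H)` acts on `SPds(H)` by `φ · δ = φ δ φ⁻¹`. -/
instance : MulAction PGOp SPds := descendAction _ scalar_smul_SPds

theorem mk_smul_SPds (φ : GOp) (δ : SPds) : (φ : PGOp) • δ = φ • δ := rfl

/-! ### The groupoid `𝒴(H)` -/

/-- The set `PGO⁺(H)² / H^* × SPds(H)² × C₂²`; an element is written
`((ζ, η), (δ, ε), (λ, μ))`. -/
@[ext] structure YObj : Type where
  /-- the class of `(ζ, η)` -/
  pair : YPair
  /-- the map `δ` -/
  δ : SPds
  /-- the map `ε` -/
  ε : SPds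
  /-- the element `λ` of `C₂` -/
  l : C2
  /-- the element `μ` of `C₂` -/
  m : C2

theorem pair_wd {φ φ₁ φ₂ ψ₁ ψ₂ : GOp} (h : IsTriality φ φ₁ φ₂) (h' : IsTriality φ ψ₁ ψ₂)
    (a b : PGOp) {p q : PGOp × PGOp}
    (hpq : (nuclearSetoid (QuotientGroup.mk' (scalars.subgroupOf GOp))).r p q) :
    YPair.mk ((ψ₁ : PGOp) * p.1 * a) ((ψ₂ : PGOp) * p.2 * b)
      = YPair.mk ((φ₁ : PGOp) * q.1 * a) ((φ₂ : PGOp) * q.2 * b) := by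
  obtain ⟨w, rfl⟩ := (nuclearSetoid_rel _ _ _).1 hpq
  obtain ⟨v, h1, h2⟩ := h.unique (h'.shift w)
  apply Quotient.sound
  refine (nuclearSetoid_rel _ _ _).2 ⟨v, ?_⟩
  have e1 := congrArg (QuotientGroup.mk' (scalars.subgroupOf GOp)) h1
  have e2 := congrArg (QuotientGroup.mk' (scalars.subgroupOf GOp)) h2
  simp only [map_mul, map_inv] at e1 e2
  refine Prod.ext ?_ ?_
  · simp only [← mul_assoc]
    exact congrArg (fun t => t * q.1 * a) e1.symm
  · simp only [← mul_assoc]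
    exact congrArg (fun t => t * q.2 * b) e2.symm

/-- `(ζ, η) ↦ (φ₁ ζ φ^{-λ}, φ₂ η φ^{-μ})` on `PGO⁺(H)² / H^*`, where `φ₁, φ₂` are triality
components of `φ`; `pairAct_mk` says that their choice does not matter. -/
def pairAct (φ : GOp) (l m : C2) (p : YPair) : YPair :=
  Quotient.lift
    (fun q : PGOp × PGOp =>
      YPair.mk (((exists_triality φ).choose : PGOp) * q.1 * (conjP l φ)⁻¹)
        (((exists_triality φ).choose_spec.choose : PGOp) * q.2 * (conjP m φ)⁻¹))
    (fun _ _ h => pair_wd (exists_triality φ).choose_spec.choose_spec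
      (exists_triality φ).choose_spec.choose_spec _ _ h) p

theorem pairAct_mk {φ φ₁ φ₂ : GOp} (h : IsTriality φ φ₁ φ₂) (l m : C2) (ζ η : PGOp) :
    pairAct φ l m (YPair.mk ζ η) =
      YPair.mk ((φ₁ : PGOp) * ζ * (conjP l φ)⁻¹) ((φ₂ : PGOp) * η * (conjP m φ)⁻¹) :=
  pair_wd h (exists_triality φ).choose_spec.choose_spec _ _
    ((nuclearSetoid (QuotientGroup.mk' (scalars.subgroupOf GOp))).refl (ζ, η))

/-- The action
`φ · ((ζ,η),(δ,ε),(λ,μ)) = ((φ₁ ζ φ^{-λ}, φ₂ η φ^{-μ}), (φ^λ δ φ^{-λ}, φ^μ ε φ^{-μ}), (λ,μ))`,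
first for `φ ∈ GO⁺(H)`. -/
instance : MulAction GOp YObj where
  smul φ y := ⟨pairAct φ y.l y.m y.pair, conjP y.l φ • y.δ, conjP y.m φ • y.ε, y.l, y.m⟩
  one_smul y := by
    obtain ⟨p, δ, ε, l, m⟩ := y
    obtain ⟨⟨ζ, η⟩, rfl⟩ := Quotient.exists_rep p
    have h : IsTriality 1 1 1 := fun x y => rfl
    change YObj.mk (pairAct 1 l m (YPair.mk ζ η)) (conjP l ((1 : GOp) : PGOp) • δ)
      (conjP m ((1 : GOp) : PGOp) • ε) l m = YObj.mk (YPair.mk ζ η) δ ε l m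
    rw [pairAct_mk h]
    simp
  mul_smul φ ψ y := by
    obtain ⟨p, δ, ε, l, m⟩ := y
    obtain ⟨⟨ζ, η⟩, rfl⟩ := Quotient.exists_rep p
    obtain ⟨φ₁, φ₂, h⟩ := exists_triality φ
    obtain ⟨ψ₁, ψ₂, h'⟩ := exists_triality ψ
    change YObj.mk (pairAct (φ * ψ) l m (YPair.mk ζ η)) (conjP l ((φ * ψ : GOp) : PGOp) • δ)
      (conjP m ((φ * ψ : GOp) : PGOp) • ε) l m
      = YObj.mk (pairAct φ l m (pairAct ψ l m (YPair.mk ζ η)))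
        (conjP l (φ : PGOp) • conjP l (ψ : PGOp) • δ)
        (conjP m (φ : PGOp) • conjP m (ψ : PGOp) • ε) l m
    rw [pairAct_mk h', pairAct_mk h, pairAct_mk (h.mul h')]
    simp [mul_assoc, mul_smul]

theorem scalar_smul_YObj (φ : GOp) (hφ : φ ∈ scalars.subgroupOf GOp) (y : YObj) : φ • y = y := by
  obtain ⟨p, δ, ε, l, m⟩ := y
  obtain ⟨⟨ζ, η⟩, rfl⟩ := Quotient.exists_rep p
  have h : IsTriality φ φ 1 := by
    obtain ⟨ρ, hρ⟩ := mem_scalars.1 (Subgroup.mem_subgroupOf.1 hφ)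
    intro x y
    change φ.1 (x * y) = φ.1 x * y
    rw [hρ, hρ, smul_mul_assoc]
  have e : (φ : PGOp) = 1 := (QuotientGroup.eq_one_iff φ).2 hφ
  change YObj.mk (pairAct φ l m (YPair.mk ζ η)) (conjP l (φ : PGOp) • δ)
      (conjP m (φ : PGOp) • ε) l m = YObj.mk (YPair.mk ζ η) δ ε l m
  rw [pairAct_mk h, e]
  simp

/-- The action of `PGO⁺(H)` on `PGO⁺(H)² / H^* × SPds(H)² × C₂²`. -/
instance : MulAction PGOp YObj := descendAction _ scalar_smul_YObj

/-- The defining formula of the action, for any choice of triality components. -/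
theorem mk_smul_YObj {φ φ₁ φ₂ : GOp} (h : IsTriality φ φ₁ φ₂) (ζ η : PGOp) (δ ε : SPds)
    (l m : C2) :
    (φ : PGOp) • (⟨YPair.mk ζ η, δ, ε, l, m⟩ : YObj) =
      ⟨YPair.mk ((φ₁ : PGOp) * ζ * (conjP l φ)⁻¹) ((φ₂ : PGOp) * η * (conjP m φ)⁻¹),
        conjP l φ • δ, conjP m φ • ε, l, m⟩ := by
  rw [← pairAct_mk h]
  rfl

/-- The groupoid `𝒴(H)` of the action. -/
abbrev YCat : Type := ActionCategory PGOp YObj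

/-! ### The double sign decomposition -/

/-- The map `((ζ,η),(δ,ε),(λ,μ)) ↦ (ζδλ, ηεμ)` from the objects of `𝒴(H)` to those
of `𝒳(H)`. -/
def toX (y : YObj) : XObj :=
  Quotient.map (sa := nuclearSetoid (QuotientGroup.mk' (scalars.subgroupOf GOp)))
    (sb := nuclearSetoid ((QuotientGroup.mk' scalars).comp GOp.subtype))
    (fun p : PGOp × PGOp =>
      (inclPGL p.1 * (y.δ.toGL : PGL) * (y.l.1 : PGL),
        inclPGL p.2 * (y.ε.toGL : PGL) * (y.m.1 : PGL)))
    (by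
      intro p q hpq
      obtain ⟨w, rfl⟩ := (nuclearSetoid_rel _ _ _).1 hpq
      refine (nuclearSetoid_rel _ _ _).2 ⟨w, Prod.ext ?_ ?_⟩
      · simp only [map_mul, map_inv, ← mul_assoc]; rfl
      · simp only [map_mul, ← mul_assoc]; rfl)
    y.pair

/-- `sign (det α)` for `α ∈ PGL(H)`; as `dim H = 4` this does not depend on the
representative, and it is the class of `det α` in `ℝ^* / (ℝ^*)⁴ = {±1}`. -/
def signDet : PGL →* SignType :=
  QuotientGroup.lift scalars
    ((signHom : ℝ →*₀ SignType).toMonoidHom.comp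
      (LinearMap.det.comp (LinearEquiv.automorphismGroup.toLinearMapMonoidHom)))
    (by
      intro φ hφ
      obtain ⟨ρ, hρ⟩ := mem_scalars.1 hφ
      have e : (φ : H →ₗ[ℝ] H) = (ρ : ℝ) • LinearMap.id := LinearMap.ext hρ
      change SignType.sign (LinearMap.det (φ : H →ₗ[ℝ] H)) = 1
      rw [e, LinearMap.det_smul, LinearMap.det_id, mul_one, Quaternion.finrank_eq_four]
      exact sign_pos (by have := ρ.ne_zero; positivity))

theorem signDet_mk (φ : GLH) :
    signDet (φ : PGL) = SignType.sign (LinearMap.det (φ : H →ₗ[ℝ] H)) := rfl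

theorem signDet_GOp (φ : GOp) : signDet (φ.1 : PGL) = 1 := by
  obtain ⟨φ, μ, h1, h2⟩ := φ
  rw [signDet_mk, h2]
  exact sign_pos (pow_pos h1.pos 2)

/-- The double sign `(sign det α, sign det β)` of `(α, β) ∈ X_H`. -/
def doubleSign (x : XObj) : SignType × SignType :=
  Quotient.lift (fun p : PGL × PGL => (signDet p.1, signDet p.2))
    (by
      intro p q hpq
      obtain ⟨w, rfl⟩ := (nuclearSetoid_rel _ _ _).1 hpq
      have h1 : signDet ((Rg w).1 : PGL)⁻¹ = 1 := signDet_GOp (Rg w)⁻¹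
      have h2 : signDet ((Lg w).1 : PGL) = 1 := signDet_GOp (Lg w)
      refine Prod.ext ?_ ?_
      · exact (map_mul signDet _ _).trans (by erw [h1, one_mul])
      · exact (map_mul signDet _ _).trans (by erw [h2, one_mul])) x

/-- `𝒴(H)_{i,j}`, the full subcategory of `𝒴(H)` formed by the objects whose image in `𝒳(H)`
has double sign `(i, j)`. -/
def ySign (i j : SignType) : ObjectProperty YCat := fun y => doubleSign (toX y.back) = (i, j)

/-- The category `𝒴(H)_{i,j}`. -/
abbrev YSub (i j : SignType) : Type := (ySign i j).FullSubcategory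

/-! ### The groupoid `𝒵` -/

/-- The subgroup `ℝ^*` of `H^*`. -/
def realUnits : Subgroup Hˣ := (Units.map (algebraMap ℝ H : ℝ →* H)).range

theorem realUnits_comm {r : Hˣ} (hr : r ∈ realUnits) (x : H) : (r : H) * x = x * r := by
  obtain ⟨ρ, rfl⟩ := hr
  exact Algebra.commutes (ρ : ℝ) x

instance : realUnits.Normal := by
  constructor
  intro n hn g
  have : g * n * g⁻¹ = n := by
    rw [mul_inv_eq_iff_eq_mul]
    exact Units.ext (realUnits_comm hn g).symm
  rwa [this]

/-- `H^* / ℝ^*`. -/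
abbrev PH : Type := Hˣ ⧸ realUnits

theorem Lg_real {r : Hˣ} (hr : r ∈ realUnits) : Lg r ∈ scalars.subgroupOf GOp := by
  obtain ⟨ρ, rfl⟩ := hr
  refine Subgroup.mem_subgroupOf.2 (mem_scalars.2 ⟨ρ, fun x => ?_⟩)
  exact (Algebra.smul_def (ρ : ℝ) x).symm

theorem Rg_real {r : Hˣ} (hr : r ∈ realUnits) : Rg r ∈ scalars.subgroupOf GOp := by
  have : Rg r = Lg r := Subtype.ext (LinearEquiv.ext fun x => (realUnits_comm hr x).symm)
  rw [this]
  exact Lg_real hr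

/-- `a ↦ L_a`, `H^* / ℝ^* → PGO⁺(H)`. -/
def Lp (a : PH) : PGOp :=
  QuotientGroup.map realUnits (scalars.subgroupOf GOp)
    { toFun := Lg, map_one' := Lg_one, map_mul' := Lg_mul } (fun _ h => Lg_real h) a

/-- `a ↦ R_a`, `H^* / ℝ^* → PGO⁺(H)`. -/
def Rp (a : PH) : PGOp :=
  Quotient.map' Rg (by
    intro a b h
    rw [QuotientGroup.leftRel_apply] at h ⊢
    have e : (Rg a)⁻¹ * Rg b = Rg (a * (a⁻¹ * b) * a⁻¹) := by
      rw [inv_mul_eq_iff_eq_mul, ← Rg_mul]; simp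
    rw [e]
    exact Rg_real ((inferInstance : realUnits.Normal).conj_mem _ h a)) a

/-- `a ↦ c_a = L_a R_a⁻¹`, `H^* / ℝ^* → PGO⁺(H)`. -/
def c : PH →* PGOp :=
  QuotientGroup.map realUnits (scalars.subgroupOf GOp)
    { toFun := fun a => Lg a * (Rg a)⁻¹
      map_one' := by simp [Lg_one, Rg_one]
      map_mul' := fun a b => by
        have h : Lg b * (Rg a)⁻¹ = (Rg a)⁻¹ * Lg b := by
          rw [mul_inv_eq_iff_eq_mul, mul_assoc, Lg_comm_Rg, inv_mul_cancel_left]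
        rw [Lg_mul, Rg_mul, mul_inv_rev, mul_assoc, mul_assoc, ← mul_assoc (Lg b), h]
        simp [mul_assoc] }
    (fun _ h => mul_mem (Lg_real h) (inv_mem (Rg_real h)))

theorem Lp_mk (a : Hˣ) : Lp (a : PH) = (Lg a : PGOp) := rfl
theorem Rp_mk (a : Hˣ) : Rp (a : PH) = (Rg a : PGOp) := rfl
theorem c_eq (a : PH) : c a = Lp a * (Rp a)⁻¹ := by
  obtain ⟨a, rfl⟩ := QuotientGroup.mk_surjective a
  rfl

/-- The set `(H^*/ℝ^*)² × SPds(H)²`; an element is written `((a, b), (δ, ε))`. -/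
@[ext] structure ZObj : Type where
  /-- the line `a` -/
  a : PH
  /-- the line `b` -/
  b : PH
  /-- the map `δ` -/
  δ : SPds
  /-- the map `ε` -/
  ε : SPds

/-- The action `s · ((a,b),(δ,ε)) = ((s a s⁻¹, s b s⁻¹), (c_s δ c_s⁻¹, c_s ε c_s⁻¹))`. -/
instance : MulAction PH ZObj where
  smul s z := ⟨s * z.a * s⁻¹, s * z.b * s⁻¹, c s • z.δ, c s • z.ε⟩
  one_smul z := by
    change ZObj.mk (1 * z.a * 1⁻¹) (1 * z.b * 1⁻¹) (c 1 • z.δ) (c 1 • z.ε) = z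
    simp
  mul_smul s t z := by
    change ZObj.mk (s * t * z.a * (s * t)⁻¹) (s * t * z.b * (s * t)⁻¹) (c (s * t) • z.δ)
      (c (s * t) • z.ε) = ZObj.mk (s * (t * z.a * t⁻¹) * s⁻¹) (s * (t * z.b * t⁻¹) * s⁻¹)
      (c s • c t • z.δ) (c s • c t • z.ε)
    simp [mul_assoc, mul_smul]

/-- The groupoid `𝒵` of the action. -/
abbrev ZCat : Type := ActionCategory PH ZObj

/-- The functor `F : 𝒵 ⥤ 𝒴(H)_{i,j}` is given by `h` on objects and by `s ↦ c_s` on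
morphisms. -/
def IsGivenBy {i j : SignType} (F : ZCat ⥤ YSub i j) (h : ZObj → YObj) : Prop :=
  (∀ z : ZCat, (F.obj z).obj.back = h z.back) ∧
    ∀ (z z' : ZCat) (f : z ⟶ z'), (F.map f).hom.val = c f.val

end

end QuatIsotopes

namespace QuatIsotopes

/-! Every element of `PGOp` is the class of `x ↦ p x q` for exactly one pair `(p, q)` in `PH × PH`:
existence (`LR_surjective`) is Skolem–Noether, uniqueness (`LR_inj`) is the fact that the centre of
`H` is `ℝ`. In these coordinates all the data become explicit. The triality components of `(p, q)`
are `L_p` and `R_q`, and conjugation by `κ` sends `(p, q)` to `(q⁻¹, p⁻¹)` (`conjP_kappa`). A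
nuclear orbit has a unique representative `(LR a 1, LR b t)`, so it is a triple `(a, b, t)`.

Elements of `PGOp` and `SPds` have positive determinant, so the double sign of an object amounts to
`(λ, μ)`. With `(λ, μ)` fixed, `(p, q)` acts on the triple, and one coordinate is multiplied on both
sides so that it can be moved to `1`: (1, 1): `b ↦ q⁻¹ b p⁻¹`; (-1, 1): `a ↦ p a q`; (1, -1): `t ↦ p
t q`; (-1, -1): `b ↦ p b q`. The triples with that coordinate equal to `1` are the objects in the
image of the functor. A morphism between two of them must have `q = p⁻¹`, hence is `c_p`, and `c_p`
conjugates the two remaining coordinates by `p`. This is the groupoid `𝒵`. -/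

/-! ### Coordinates on `PGOp`: two-sided multiplications -/

/-- The class of the map `x ↦ p x q` in `PGO⁺(H)`. -/
noncomputable def LR (p q : PH) : PGOp := Lp p * Rp q

theorem LR_mk (p q : Hˣ) : LR p q = ((Lg p * Rg q : GOp) : PGOp) := rfl

theorem Lp_eq_LR (p : PH) : Lp p = LR p 1 := by
  obtain ⟨p, rfl⟩ := QuotientGroup.mk_surjective p
  rw [← QuotientGroup.mk_one, LR_mk, Rg_one, mul_one, Lp_mk]

theorem Rp_eq_LR (q : PH) : Rp q = LR 1 q := by
  obtain ⟨q, rfl⟩ := QuotientGroup.mk_surjective q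
  rw [← QuotientGroup.mk_one, LR_mk, Lg_one, one_mul, Rp_mk]

theorem LR_one : LR 1 1 = 1 := by
  rw [← QuotientGroup.mk_one, LR_mk, Lg_one, Rg_one, one_mul, QuotientGroup.mk_one]

/-- The second argument multiplies in the opposite order, as right multiplications do: `LR`
identifies `PGOp` with `PH × PHᵐᵒᵖ`. -/
theorem LR_mul (a b p q : PH) : LR a b * LR p q = LR (a * p) (q * b) := by
  obtain ⟨a, rfl⟩ := QuotientGroup.mk_surjective a
  obtain ⟨b, rfl⟩ := QuotientGroup.mk_surjective b
  obtain ⟨p, rfl⟩ := QuotientGroup.mk_surjective p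
  obtain ⟨q, rfl⟩ := QuotientGroup.mk_surjective q
  rw [← QuotientGroup.mk_mul, ← QuotientGroup.mk_mul, LR_mk, LR_mk, LR_mk,
    ← QuotientGroup.mk_mul, Lg_mul, Rg_mul, mul_assoc, mul_assoc, ← mul_assoc (Rg b),
    ← Lg_comm_Rg, mul_assoc]

theorem LR_inv (a b : PH) : (LR a b)⁻¹ = LR a⁻¹ b⁻¹ :=
  inv_eq_of_mul_eq_one_right (by rw [LR_mul, mul_inv_cancel, inv_mul_cancel, LR_one])

theorem c_eq_LR (s : PH) : c s = LR s s⁻¹ := by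
  rw [c_eq, Lp_eq_LR, Rp_eq_LR, LR_inv, LR_mul]
  simp

/-- Commuting with `i` and `j` already kills all three imaginary coordinates. -/
theorem mem_realUnits_of_central {s : Hˣ} (h : ∀ x : H, (s : H) * x = x * s) :
    s ∈ realUnits := by
  have hi := h qI
  have hj := h qJ
  have e : (s : H) = algebraMap ℝ H (s : H).re := by
    have i1 := congrArg (fun q => q.imJ) hi
    have i2 := congrArg (fun q => q.imK) hi
    have j1 := congrArg (fun q => q.imK) hj
    simp at i1 i2 j1
    change _ = (((s : H).re : ℝ) : H)
    ext <;> simp <;> linarith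
  have hr : (s : H).re ≠ 0 := by
    intro h0
    rw [h0, map_zero] at e
    exact s.ne_zero e
  exact ⟨Units.mk0 _ hr, Units.ext e.symm⟩

theorem LR_eq_one {p q : PH} (h : LR p q = 1) : p = 1 ∧ q = 1 := by
  obtain ⟨p, rfl⟩ := QuotientGroup.mk_surjective p
  obtain ⟨q, rfl⟩ := QuotientGroup.mk_surjective q
  rw [LR_mk, QuotientGroup.eq_one_iff] at h
  obtain ⟨ρ, hρ⟩ := mem_scalars.1 (Subgroup.mem_subgroupOf.1 h)
  replace hρ (x : H) : (p : H) * (x * q) = (ρ : ℝ) • x := hρ x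
  have h1 : (p : H) * q = (ρ : ℝ) • 1 := by simpa using hρ 1
  have hp : p ∈ realUnits := by
    refine mem_realUnits_of_central fun x => ?_
    -- The scalar is `p q`, by evaluation at `1`; hence `p x q = x p q`, and cancelling `q` makes
    -- `p` central.
    have h2 : (p : H) * (x * q) = x * (p * q) := by
      rw [hρ, h1, mul_smul_comm, mul_one]
    rw [← mul_assoc, ← mul_assoc] at h2
    exact mul_right_cancel₀ q.ne_zero h2
  have hq : p * q ∈ realUnits := ⟨ρ, Units.ext (by simp [h1, Algebra.algebraMap_eq_smul_one])⟩
  exact ⟨(QuotientGroup.eq_one_iff p).2 hp,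
    (QuotientGroup.eq_one_iff q).2 ((Subgroup.mul_mem_cancel_left _ hp).1 hq)⟩

theorem LR_inj {a b p q : PH} : LR a b = LR p q ↔ a = p ∧ b = q := by
  refine ⟨fun h => ?_, by rintro ⟨rfl, rfl⟩; rfl⟩
  have h1 : LR (a * p⁻¹) (q⁻¹ * b) = 1 := by rw [← LR_mul, ← LR_inv, h, mul_inv_cancel]
  obtain ⟨h2, h3⟩ := LR_eq_one h1
  exact ⟨mul_inv_eq_one.1 h2, (inv_mul_eq_one.1 h3).symm⟩

theorem c_injective : Function.Injective c := fun s t h => by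
  rw [c_eq_LR, c_eq_LR, LR_inj] at h
  exact h.1

/-- A multiplicative automorphism of `H` which is a proper similitude is inner. -/
theorem exists_inner_of_fix_one {ψ : GOp} (h1 : ψ.1 1 = 1) :
    ∃ s : Hˣ, ψ = Lg s * (Rg s)⁻¹ := by
  have hm := mul_of_fix_one ψ.2 h1
  have ii : qI * qI = -1 := by ext <;> simp
  have jj : qJ * qJ = -1 := by ext <;> simp
  have ij : qI * qJ = qK := by ext <;> simp
  have ji : qJ * qI = -qK := by ext <;> simp
  have kk : qK * qK = -1 := by ext <;> simp
  have jk : qJ * qK = qI := by ext <;> simp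
  have kj : qK * qJ = -qI := by ext <;> simp
  have ki : qK * qI = qJ := by ext <;> simp
  have ik : qI * qK = -qJ := by ext <;> simp
  obtain ⟨u, hu⟩ : ∃ u, ψ.1 qI = u := ⟨_, rfl⟩
  obtain ⟨v, hv⟩ : ∃ v, ψ.1 qJ = v := ⟨_, rfl⟩
  obtain ⟨w, hw⟩ : ∃ w, ψ.1 qK = w := ⟨_, rfl⟩
  have uu : u * u = -1 := by rw [← hu, ← hm, ii, map_neg, h1]
  have vv : v * v = -1 := by rw [← hv, ← hm, jj, map_neg, h1]
  have uv : u * v = w := by rw [← hu, ← hv, ← hm, ij, hw]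
  have vu : v * u = -w := by rw [← hu, ← hv, ← hm, ji, map_neg, hw]
  have uw : u * w = -v := by rw [← hu, ← hv, ← hw, ← hm, ik, map_neg]
  have vw : v * w = u := by rw [← hu, ← hv, ← hw, ← hm, jk]
  -- Skolem–Noether by averaging: the sum of `ψ(e) t e⁻¹` over `e = 1, i, j, k` intertwines `ψ` with
  -- the identity, so it is the required `s` once it is nonzero.
  obtain ⟨t, ht⟩ : ∃ t : H, t - u * t * qI - v * t * qJ - w * t * qK ≠ 0 := by
    by_contra! h
    -- Call the average `f(t)`. The sum of `f(e) e⁻¹` over `e = 1, i, j, k` is `4`, since the sum of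
    -- `e x e⁻¹` is `4 Re x`, which removes every term except the one with `ψ(1) = 1`. So `f` cannot
    -- vanish identically.
    have e : ((4 : ℝ) : H) = (1 - u * 1 * qI - v * 1 * qJ - w * 1 * qK)
        - (qI - u * qI * qI - v * qI * qJ - w * qI * qK) * qI
        - (qJ - u * qJ * qI - v * qJ * qJ - w * qJ * qK) * qJ
        - (qK - u * qK * qI - v * qK * qJ - w * qK * qK) * qK := by
      simp only [sub_mul, mul_assoc, ii, jj, kk, ij, ji, jk, kj, ki, ik, mul_neg, neg_mul,
        mul_one]
      have e4 : ((4 : ℝ) : H) = 1 + 1 + 1 + 1 := by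
        rw [show (4 : ℝ) = 1 + 1 + 1 + 1 by norm_num]
        simp only [Quaternion.coe_add, Quaternion.coe_one]
      rw [e4]
      noncomm_ring
    simp only [h, zero_mul, sub_zero] at e
    have e0 := congrArg (fun q => q.re) e
    simp at e0
  obtain ⟨s, hs⟩ : ∃ s : H, t - u * t * qI - v * t * qJ - w * t * qK = s := ⟨_, rfl⟩
  rw [hs] at ht
  have hsI : u * s = s * qI := by
    simp only [← hs, sub_mul, mul_sub, mul_assoc, ii, ji, ki]
    simp only [← mul_assoc, uu, uv, uw]
    noncomm_ring
  have hsJ : v * s = s * qJ := by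
    simp only [← hs, sub_mul, mul_sub, mul_assoc, ij, jj, kj]
    simp only [← mul_assoc, vu, vv, vw]
    noncomm_ring
  have hsK : w * s = s * qK := by
    rw [← uv, mul_assoc, hsJ, ← mul_assoc, hsI, mul_assoc, ij]
  have hc : Commute (Lg (Units.mk0 s ht)) (Rg (Units.mk0 s ht)) := Lg_comm_Rg _ _
  refine ⟨Units.mk0 s ht, ?_⟩
  rw [hc.inv_right.eq]
  refine eq_inv_mul_of_mul_eq (Subtype.ext (LinearEquiv.ext fun x => ?_))
  change ψ.1 x * s = s * x
  have hx : x = x.re • (1 : H) + x.imI • qI + x.imJ • qJ + x.imK • qK := by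
    ext <;> simp
  rw [hx]
  simp only [map_add, map_smul, h1, hu, hv, hw, add_mul, mul_add, smul_mul_assoc,
    mul_smul_comm, hsI, hsJ, hsK, mul_one, one_mul]

theorem LR_surjective (φ : PGOp) : ∃ p q, φ = LR p q := by
  obtain ⟨φ, rfl⟩ := QuotientGroup.mk_surjective φ
  have h : φ.1 1 ≠ 0 := by simp
  let a : Hˣ := Units.mk0 _ h
  -- Dividing by `a = φ(1)` leaves an inner automorphism, so `φ` is `x ↦ a s x s⁻¹`.
  obtain ⟨s, hs⟩ := exists_inner_of_fix_one (ψ := (Lg a)⁻¹ * φ) (by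
    change ((a⁻¹ : Hˣ) : H) * φ.1 1 = 1
    exact a.inv_mul)
  rw [inv_mul_eq_iff_eq_mul] at hs
  refine ⟨(a : PH) * s, (s : PH)⁻¹, ?_⟩
  have e : LR (a : PH) 1 * LR s (s : PH)⁻¹ = LR ((a : PH) * s) (s : PH)⁻¹ := by simp [LR_mul]
  rw [hs, ← e, ← Lp_eq_LR, ← c_eq_LR]
  rfl

/-! ### Twisting by `C₂`, nuclear orbits and the action in coordinates -/

theorem conjP_one (φ : PGOp) : conjP 1 φ = φ := by
  obtain ⟨φ, rfl⟩ := QuotientGroup.mk_surjective φ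
  change ((conjC 1 φ : GOp) : PGOp) = φ
  refine congrArg _ (Subtype.ext ?_)
  change (1 : GLH) * φ.1 * (1 : GLH)⁻¹ = φ.1
  simp

theorem star_eq_smul_inv (p : Hˣ) :
    star (p : H) = Quaternion.normSq (p : H) • ((p⁻¹ : Hˣ) : H) := by
  apply mul_left_cancel₀ p.ne_zero
  rw [Quaternion.self_mul_star, mul_smul_comm, p.mul_inv, ← Algebra.algebraMap_eq_smul_one]
  rfl

/-- Conjugation by `κ` turns `x ↦ p x q` into `x ↦ q̄ x p̄`, and modulo scalars the bar is
inversion. -/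
theorem conjP_kappa (p q : PH) : conjP kappa2 (LR p q) = LR q⁻¹ p⁻¹ := by
  obtain ⟨p, rfl⟩ := QuotientGroup.mk_surjective p
  obtain ⟨q, rfl⟩ := QuotientGroup.mk_surjective q
  rw [← QuotientGroup.mk_inv, ← QuotientGroup.mk_inv, LR_mk, LR_mk]
  change ((conjC kappa2 (Lg p * Rg q) : GOp) : PGOp) = _
  refine (QuotientGroup.eq.2 ?_).symm
  have hp : Quaternion.normSq (p : H) ≠ 0 := by simp
  have hq : Quaternion.normSq (q : H) ≠ 0 := by simp
  refine Subgroup.mem_subgroupOf.2 (mem_scalars.2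
    ⟨Units.mk0 _ hp * Units.mk0 _ hq, fun x => ?_⟩)
  change ((Lg q⁻¹ * Rg p⁻¹ : GOp).1).symm (star ((p : H) * (star x * q))) = _
  rw [LinearEquiv.symm_apply_eq]
  change _ = ((q⁻¹ : Hˣ) : H) * ((_ • x) * ((p⁻¹ : Hˣ) : H))
  rw [star_mul, star_mul, star_star, star_eq_smul_inv, star_eq_smul_inv]
  simp [mul_assoc, smul_smul]

theorem YPair.mk_eq_iff (a b a' b' : PGOp) :
    YPair.mk a b = YPair.mk a' b' ↔ ∃ w : PH, LR 1 w⁻¹ * a' = a ∧ LR w 1 * b' = b := by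
  have e (w : Hˣ) : (((Rg w : GOp) : PGOp))⁻¹ = LR 1 (w : PH)⁻¹ := by
    rw [← Rp_mk, Rp_eq_LR, LR_inv, inv_one]
  have e' (w : Hˣ) : (((Lg w : GOp) : PGOp)) = LR (w : PH) 1 := by
    rw [← Lp_mk, Lp_eq_LR]
  refine Quotient.eq.trans ((nuclearSetoid_rel _ _ _).trans ?_)
  constructor
  · rintro ⟨w, h⟩
    obtain ⟨h1, h2⟩ := Prod.ext_iff.1 h
    exact ⟨w, by rw [← e]; exact h1, by rw [← e']; exact h2⟩
  · rintro ⟨w, h1, h2⟩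
    obtain ⟨w, rfl⟩ := QuotientGroup.mk_surjective w
    rw [← e] at h1
    rw [← e'] at h2
    exact ⟨w, Prod.ext h1 h2⟩

/-- The triality components can be read off from `p (x y) q = (p x) (y q)`. -/
theorem LR_smul_YObj (p q : PH) (ζ η : PGOp) (δ ε : SPds) (l m : C2) :
    LR p q • (⟨YPair.mk ζ η, δ, ε, l, m⟩ : YObj) =
      ⟨YPair.mk (LR p 1 * ζ * (conjP l (LR p q))⁻¹) (LR 1 q * η * (conjP m (LR p q))⁻¹),
        conjP l (LR p q) • δ, conjP m (LR p q) • ε, l, m⟩ := by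
  rw [← Lp_eq_LR, ← Rp_eq_LR]
  obtain ⟨p, rfl⟩ := QuotientGroup.mk_surjective p
  obtain ⟨q, rfl⟩ := QuotientGroup.mk_surjective q
  have h : IsTriality (Lg p * Rg q) (Lg p) (Rg q) := fun x y => by
    change (p : H) * (x * y * q) = p * x * (y * q)
    simp [mul_assoc]
  exact mk_smul_YObj h ζ η δ ε l m

/-! ### The double sign -/

theorem det_kappa : LinearMap.det (kappa : H →ₗ[ℝ] H) = -1 := by
  rw [det_formula (kappa : H →ₗ[ℝ] H) (star qI) (star qJ) (star qK) (star 1) rfl rfl rfl rfl]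
  simp [Matrix.det_succ_row_zero, Fin.sum_univ_succ, Fin.succAbove]

theorem signDet_inclPGL (φ : PGOp) : signDet (inclPGL φ) = 1 := by
  obtain ⟨φ, rfl⟩ := QuotientGroup.mk_surjective φ
  exact signDet_GOp φ

theorem signDet_SPds (δ : SPds) : signDet (δ.toGL : PGL) = 1 := by
  rw [signDet_mk, δ.det, sign_one]

/-- Only `λ` and `μ` can contribute a negative determinant; with `C2.ext_signDet`, the double sign
therefore determines both. -/
theorem doubleSign_toX (y : YObj) :
    doubleSign (toX y) = (signDet (y.l.1 : PGL), signDet (y.m.1 : PGL)) := by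
  obtain ⟨p, δ, ε, l, m⟩ := y
  obtain ⟨⟨ζ, η⟩, rfl⟩ := Quotient.exists_rep p
  change (signDet (inclPGL ζ * (δ.toGL : PGL) * (l.1 : PGL)),
    signDet (inclPGL η * (ε.toGL : PGL) * (m.1 : PGL))) = _
  simp only [map_mul, signDet_inclPGL, signDet_SPds, one_mul]

theorem signDet_one : signDet (((1 : C2).1 : GLH) : PGL) = 1 := map_one signDet

theorem signDet_kappa : signDet ((kappa2.1 : GLH) : PGL) = -1 := by
  rw [signDet_mk]
  change SignType.sign (LinearMap.det (kappa : H →ₗ[ℝ] H)) = -1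
  rw [det_kappa]
  simp

theorem C2_cases (l : C2) : l = 1 ∨ l = kappa2 := by
  obtain ⟨l, rfl | rfl⟩ := l
  · exact Or.inl rfl
  · exact Or.inr rfl

theorem C2.ext_signDet {l m : C2} (h : signDet (l.1 : PGL) = signDet (m.1 : PGL)) : l = m := by
  rcases C2_cases l with rfl | rfl <;> rcases C2_cases m with rfl | rfl <;>
    simp only [signDet_one, signDet_kappa] at h <;> first | rfl | exact absurd h (by decide)

/-! ### Criterion for an equivalence -/

/-- A map on objects which is equivariant along `c`, injective, full onto its image and
essentially surjective underlies an equivalence given by `s ↦ c_s` on morphisms. -/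
theorem exists_equivalence {i j : SignType} (h : ZObj → YObj)
    (hsign : ∀ z, doubleSign (toX (h z)) = (i, j))
    (hequiv : ∀ s z, h (s • z) = c s • h z)
    (hinj : Function.Injective h)
    (hfull : ∀ (φ : PGOp) z z', φ • h z = h z' → ∃ s, c s = φ)
    (hsurj : ∀ y, doubleSign (toX y) = (i, j) → ∃ (φ : PGOp) (z : ZObj), φ • y = h z) :
    ∃ F : ZCat ⥤ YSub i j, F.IsEquivalence ∧ IsGivenBy F h := by
  let F : ZCat ⥤ YSub i j :=
    { obj z := ⟨((h z.back : YObj) : YCat), hsign z.back⟩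
      map {z z'} f := ⟨⟨c f.val, by
        change c f.val • h z.back = h z'.back
        rw [← hequiv]
        exact congrArg h f.property⟩⟩
      map_id z := by
        apply ObjectProperty.hom_ext
        exact Subtype.ext (map_one c)
      map_comp f g := by
        apply ObjectProperty.hom_ext
        exact Subtype.ext (map_mul c _ _) }
  have : F.Faithful := ⟨fun {z z'} f g hfg => by
    have : c f.val = c g.val := congrArg (fun k => k.hom.val) hfg
    exact Subtype.ext (c_injective this)⟩
  have : F.Full := ⟨fun {z z'} g => by
    -- The morphism is some `c s`; equivariance rewrites its target as `h (s • z)`, and injectivity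
    -- gives `s • z = z'`, so `s` is itself a morphism of `𝒵`.
    obtain ⟨s, hs⟩ := hfull g.hom.val z.back z'.back g.hom.property
    have hg : c s • h z.back = h z'.back := hs ▸ g.hom.property
    rw [← hequiv] at hg
    refine ⟨⟨s, hinj hg⟩, ?_⟩
    apply ObjectProperty.hom_ext
    exact Subtype.ext hs⟩
  have : F.EssSurj := ⟨fun y => by
    obtain ⟨φ, z, hz⟩ := hsurj y.obj.back y.property
    let g : y ⟶ F.obj (z : ZCat) := ⟨⟨φ, hz⟩⟩
    refine ⟨(z : ZCat), ⟨(ObjectProperty.isoMk _ ?_)⟩⟩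
    -- `g` points from `y` to the image, so its inverse is the isomorphism wanted.
    exact (Groupoid.isoEquivHom (C := YCat) _ _).symm (Groupoid.inv (obj := YCat) g.hom)⟩
  exact ⟨F, { }, fun z => rfl, fun z z' f => rfl⟩

/-! ### Normal forms and the action of `c_s` -/

theorem ZObj.smul_eq (s : PH) (z : ZObj) :
    s • z = ⟨s * z.a * s⁻¹, s * z.b * s⁻¹, c s • z.δ, c s • z.ε⟩ := rfl

/-- The nuclear action by `w` clears the right factor `w` of the first entry and moves it to the
left of the second. -/
theorem YPair.exists_rep (p : YPair) : ∃ a b t : PH, p = YPair.mk (LR a 1) (LR b t) := by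
  obtain ⟨⟨ζ, η⟩, rfl⟩ := Quotient.exists_rep p
  obtain ⟨a, w, rfl⟩ := LR_surjective ζ
  obtain ⟨b, t, rfl⟩ := LR_surjective η
  refine ⟨a, w * b, t, ?_⟩
  exact ((YPair.mk_eq_iff _ _ _ _).2 ⟨w, by simp [LR_mul], by simp [LR_mul]⟩).symm

theorem conjP_kappa_c (s : PH) : conjP kappa2 (c s) = c s := by
  rw [c_eq_LR, conjP_kappa, inv_inv]

/-- The pair `(s, s⁻¹)` is fixed by `(p, q) ↦ (q⁻¹, p⁻¹)`, so along `c` the twist by `C₂`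
disappears. -/
theorem conjP_c (l : C2) (s : PH) : conjP l (c s) = c s := by
  rcases C2_cases l with rfl | rfl
  · exact conjP_one _
  · exact conjP_kappa_c s

/-- The triality components `L_s, R_s⁻¹` are replaced by `c_s, c_s` through a nuclear shift, so that
`c_s` acts on `ζ` and `η` by plain conjugation. Equivariance in all four cases follows from this
form. -/
theorem c_smul_YObj (s : PH) (ζ η : PGOp) (δ ε : SPds) (l m : C2) :
    c s • (⟨YPair.mk ζ η, δ, ε, l, m⟩ : YObj) =
      ⟨YPair.mk (LR 1 s⁻¹ * (LR s 1 * ζ * LR s⁻¹ s)) (LR s 1 * (LR 1 s⁻¹ * η * LR s⁻¹ s)),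
        c s • δ, c s • ε, l, m⟩ := by
  rw [c_eq_LR, LR_smul_YObj, ← c_eq_LR, conjP_c, conjP_c, c_eq_LR, LR_inv, inv_inv]
  congr 1
  refine (YPair.mk_eq_iff _ _ _ _).2 ⟨s⁻¹, ?_, ?_⟩ <;> simp [← mul_assoc, LR_mul]

/-! ### The four double signs -/

theorem exists_equivalence_one_one :
    ∃ F : ZCat ⥤ YSub 1 1, F.IsEquivalence ∧
      IsGivenBy F fun z => ⟨.mk (Lp z.a) (Rp z.b), z.δ, z.ε, 1, 1⟩ := by
  refine exists_equivalence _ ?_ ?_ ?_ ?_ ?_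
  · intro z
    simp only [doubleSign_toX, signDet_one]
  · intro s z
    simp [c_smul_YObj, ZObj.smul_eq, Lp_eq_LR, Rp_eq_LR, LR_mul, mul_assoc]
  · rintro ⟨a, b, δ, ε⟩ ⟨a', b', δ', ε'⟩ h
    simp [YPair.mk_eq_iff, Lp_eq_LR, Rp_eq_LR, LR_mul, LR_inj] at h
    grind
  · rintro φ ⟨a, b, δ, ε⟩ ⟨a', b', δ', ε'⟩ h
    obtain ⟨p, q, rfl⟩ := LR_surjective φ
    simp [LR_smul_YObj, conjP_one, YPair.mk_eq_iff, Lp_eq_LR, Rp_eq_LR, LR_mul, LR_inj,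
      LR_inv] at h
    -- Both middle coordinates are `1`, so `b ↦ q⁻¹ b p⁻¹` forces `q = p⁻¹`.
    exact ⟨p, (c_eq_LR p).trans (LR_inj.2 ⟨rfl, h.1.2.1.symm⟩)⟩
  · rintro ⟨pr, δ, ε, l, m⟩ h
    rw [doubleSign_toX, Prod.mk.injEq] at h
    obtain rfl : l = 1 := C2.ext_signDet (h.1.trans signDet_one.symm)
    obtain rfl : m = 1 := C2.ext_signDet (h.2.trans signDet_one.symm)
    obtain ⟨a, b, t, rfl⟩ := pr.exists_rep
    -- Chosen to solve `q⁻¹ b p⁻¹ = 1`.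
    refine ⟨LR b 1, ⟨b * a * b⁻¹, t, conjP 1 (LR b 1) • δ,
      conjP 1 (LR b 1) • ε⟩, ?_⟩
    simp [LR_smul_YObj, conjP_one, Lp_eq_LR, Rp_eq_LR, LR_mul, LR_inv,
      mul_assoc]

theorem exists_equivalence_neg_one_one :
    ∃ F : ZCat ⥤ YSub (-1) 1, F.IsEquivalence ∧
      IsGivenBy F fun z => ⟨.mk (Rp z.a) (Rp z.b), z.δ, z.ε, kappa2, 1⟩ := by
  refine exists_equivalence _ ?_ ?_ ?_ ?_ ?_
  · intro z
    simp only [doubleSign_toX, signDet_one, signDet_kappa]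
  · intro s z
    simp [c_smul_YObj, ZObj.smul_eq, Rp_eq_LR, LR_mul, mul_assoc]
  · rintro ⟨a, b, δ, ε⟩ ⟨a', b', δ', ε'⟩ h
    simp [YPair.mk_eq_iff, Rp_eq_LR, LR_mul, LR_inj] at h
    grind
  · rintro φ ⟨a, b, δ, ε⟩ ⟨a', b', δ', ε'⟩ h
    obtain ⟨p, q, rfl⟩ := LR_surjective φ
    simp [LR_smul_YObj, conjP_one, conjP_kappa, YPair.mk_eq_iff, Rp_eq_LR, LR_mul, LR_inj,
      LR_inv] at h
    exact ⟨p, (c_eq_LR p).trans (LR_inj.2 ⟨rfl, (eq_inv_of_mul_eq_one_right h.1.1.1.symm).symm⟩)⟩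
  · rintro ⟨pr, δ, ε, l, m⟩ h
    rw [doubleSign_toX, Prod.mk.injEq] at h
    obtain rfl : l = kappa2 := C2.ext_signDet (h.1.trans signDet_kappa.symm)
    obtain rfl : m = 1 := C2.ext_signDet (h.2.trans signDet_one.symm)
    obtain ⟨a, b, t, rfl⟩ := pr.exists_rep
    -- Here `(R_a, R_b)` is the triple `(1, a, b)`, so `p a q = 1` has to be solved. Any `p` with `q
    -- = (p a)⁻¹` does; `p = b` keeps the coordinate `p b p⁻¹` equal to `b`.
    refine ⟨LR b (b * a)⁻¹, ⟨b, b * a * t * (b * a)⁻¹, conjP kappa2 (LR b (b * a)⁻¹) • δ,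
      conjP 1 (LR b (b * a)⁻¹) • ε⟩, ?_⟩
    simp [LR_smul_YObj, conjP_one, conjP_kappa, Rp_eq_LR, LR_mul, LR_inv, mul_assoc]

theorem exists_equivalence_one_neg_one :
    ∃ F : ZCat ⥤ YSub 1 (-1), F.IsEquivalence ∧
      IsGivenBy F fun z => ⟨.mk (Lp z.a) (Lp z.b), z.δ, z.ε, 1, kappa2⟩ := by
  refine exists_equivalence _ ?_ ?_ ?_ ?_ ?_
  · intro z
    simp only [doubleSign_toX, signDet_one, signDet_kappa]
  · intro s z
    simp [c_smul_YObj, ZObj.smul_eq, Lp_eq_LR, LR_mul, mul_assoc]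
  · rintro ⟨a, b, δ, ε⟩ ⟨a', b', δ', ε'⟩ h
    simp [YPair.mk_eq_iff, Lp_eq_LR, LR_mul, LR_inj] at h
    grind
  · rintro φ ⟨a, b, δ, ε⟩ ⟨a', b', δ', ε'⟩ h
    obtain ⟨p, q, rfl⟩ := LR_surjective φ
    simp [LR_smul_YObj, conjP_one, conjP_kappa, YPair.mk_eq_iff, Lp_eq_LR, LR_mul, LR_inj,
      LR_inv] at h
    exact ⟨p, (c_eq_LR p).trans (LR_inj.2 ⟨rfl, (eq_inv_of_mul_eq_one_right h.1.2.2.symm).symm⟩)⟩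
  · rintro ⟨pr, δ, ε, l, m⟩ h
    rw [doubleSign_toX, Prod.mk.injEq] at h
    obtain rfl : l = 1 := C2.ext_signDet (h.1.trans signDet_one.symm)
    obtain rfl : m = kappa2 := C2.ext_signDet (h.2.trans signDet_kappa.symm)
    obtain ⟨a, b, t, rfl⟩ := pr.exists_rep
    -- Now the last coordinate must become `1`: this solves `p t q = 1`.
    refine ⟨LR t⁻¹ 1, ⟨t⁻¹ * a * t, b, conjP 1 (LR t⁻¹ 1) • δ,
      conjP kappa2 (LR t⁻¹ 1) • ε⟩, ?_⟩
    simp [LR_smul_YObj, conjP_one, conjP_kappa, Lp_eq_LR, LR_mul, LR_inv, mul_assoc]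

theorem exists_equivalence_neg_one_neg_one :
    ∃ F : ZCat ⥤ YSub (-1) (-1), F.IsEquivalence ∧
      IsGivenBy F fun z => ⟨.mk (Lp z.a) (Rp z.b), z.δ, z.ε, kappa2, kappa2⟩ := by
  refine exists_equivalence _ ?_ ?_ ?_ ?_ ?_
  · intro z
    simp only [doubleSign_toX, signDet_kappa]
  · intro s z
    simp [c_smul_YObj, ZObj.smul_eq, Lp_eq_LR, Rp_eq_LR, LR_mul, mul_assoc]
  · rintro ⟨a, b, δ, ε⟩ ⟨a', b', δ', ε'⟩ h
    simp [YPair.mk_eq_iff, Lp_eq_LR, Rp_eq_LR, LR_mul, LR_inj] at h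
    grind
  · rintro φ ⟨a, b, δ, ε⟩ ⟨a', b', δ', ε'⟩ h
    obtain ⟨p, q, rfl⟩ := LR_surjective φ
    simp [LR_smul_YObj, conjP_kappa, YPair.mk_eq_iff, Lp_eq_LR, Rp_eq_LR, LR_mul, LR_inj,
      LR_inv] at h
    exact ⟨p, (c_eq_LR p).trans (LR_inj.2 ⟨rfl, (by rw [← h.1.1.2, inv_inv])⟩)⟩
  · rintro ⟨pr, δ, ε, l, m⟩ h
    rw [doubleSign_toX, Prod.mk.injEq] at h
    obtain rfl : l = kappa2 := C2.ext_signDet (h.1.trans signDet_kappa.symm)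
    obtain rfl : m = kappa2 := C2.ext_signDet (h.2.trans signDet_kappa.symm)
    obtain ⟨a, b, t, rfl⟩ := pr.exists_rep
    -- Solves `p b q = 1`; the other coordinates change by the same rule, `a ↦ p a q` and `t ↦ p t
    -- q`.
    refine ⟨LR 1 b⁻¹, ⟨a * b⁻¹, t * b⁻¹, conjP kappa2 (LR 1 b⁻¹) • δ,
      conjP kappa2 (LR 1 b⁻¹) • ε⟩, ?_⟩
    simp [LR_smul_YObj, conjP_kappa, Lp_eq_LR, Rp_eq_LR, LR_mul, LR_inv]

end QuatIsotopes

theorem proposition3p2 :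
    (∃ F : QuatIsotopes.ZCat ⥤ QuatIsotopes.YSub 1 1, F.IsEquivalence ∧
      QuatIsotopes.IsGivenBy F fun z =>
        ⟨.mk (QuatIsotopes.Lp z.a) (QuatIsotopes.Rp z.b), z.δ, z.ε, 1, 1⟩) ∧
    (∃ F : QuatIsotopes.ZCat ⥤ QuatIsotopes.YSub (-1) 1, F.IsEquivalence ∧
      QuatIsotopes.IsGivenBy F fun z =>
        ⟨.mk (QuatIsotopes.Rp z.a) (QuatIsotopes.Rp z.b), z.δ, z.ε, QuatIsotopes.kappa2, 1⟩) ∧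
    (∃ F : QuatIsotopes.ZCat ⥤ QuatIsotopes.YSub 1 (-1), F.IsEquivalence ∧
      QuatIsotopes.IsGivenBy F fun z =>
        ⟨.mk (QuatIsotopes.Lp z.a) (QuatIsotopes.Lp z.b), z.δ, z.ε, 1, QuatIsotopes.kappa2⟩) ∧
    (∃ F : QuatIsotopes.ZCat ⥤ QuatIsotopes.YSub (-1) (-1), F.IsEquivalence ∧
      QuatIsotopes.IsGivenBy F fun z =>
        ⟨.mk (QuatIsotopes.Lp z.a) (QuatIsotopes.Rp z.b), z.δ, z.ε,
          QuatIsotopes.kappa2, QuatIsotopes.kappa2⟩) :=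
  ⟨QuatIsotopes.exists_equivalence_one_one,
    QuatIsotopes.exists_equivalence_neg_one_one,
    QuatIsotopes.exists_equivalence_one_neg_one,
    QuatIsotopes.exists_equivalence_neg_one_neg_one⟩
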